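/- Let $d,T\ge 1$ and write $x=(x_1,\dots,x_T)\in\mathbb{R}^{dT}$ with $x_t\in\mathbb{R}^d$, $x_{1:t}=(x_1,\dots,x_t)$, and $\|x\|=\sum_{t=1}^T\|x_t\|_{\mathbb{R}^d}$, where $\|\cdot\|_{\mathbb{R}^d}$ is the Euclidean norm. For Borel probability measures $\mu,\nu$ on $\mathbb{R}^{dT}$, a coupling $\pi$ of $\mu$ and $\nu$ is called bi-causal if for every $t=1,\dots,T-1$ and $\pi$-almost every $(x,y)$ the conditional law under $\pi$ of $(x_{t+1},y_{t+1})$ given $(x_{1:t},y_{1:t})$ is a coupling of the conditional law under $\mu$ of $x_{t+1}$ given $x_{1:t}$ and the conditional law under $\nu$ of $y_{t+1}$ given $y_{1:t}$. Let $$\mathcal{AW}_1(\mu,\nu)=\inf_{\pi}\int\|x-y\|\,\pi(dx,dy),$$ where the infimum is over all bi-causal couplings $\pi$ of $\mu$ and $\nu$. For $\sigma>0$ let $\mathcal{N}_\sigma=\mathcal{N}(0,\sigma^2 I_{dT})$ and $\mathcal{AW}_1^{(\sigma)}(\mu,\nu)=\mathcal{AW}_1(\mu*\mathcal{N}_\sigma,\nu*\mathcal{N}_\sigma)$.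 Theorem. Let $\mu$ be a Borel probability measure on $\mathbb{R}^{dT}$ with $\int\|x\|\,\mu(dx)<\infty$, let $(X^{(n)})_{n\in\mathbb{N}}$ be i.i.d. random variables with law $\mu$ on a probability space $(\Omega,\mathcal{F},\mathbb{P})$, and let $\mu^N=\frac1N\sum_{n=1}^N\delta_{X^{(n)}}$ be the empirical measures. Then, for every $\sigma\in(0,1]$, $$\lim_{N\to\infty}\mathcal{AW}_1^{(\sigma)}(\mu,\mu^N)=0\qquad\mathbb{P}\text{-almost surely}.$$ -/

import Mathlib

open MeasureTheory ProbabilityTheory Filter Topology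
open scoped ENNReal

noncomputable section

/-- Paths `x = (x_1, …, x_T)` of length `T` with values in the Euclidean space `ℝᵈ`, i.e. `ℝ^{dT}`
(times are indexed by `Fin T`, so `x 0` is the value at the first time). -/
abbrev PathSpace (d T : ℕ) : Type := Fin T → EuclideanSpace ℝ (Fin d)

variable {d T : ℕ}

/-- The sum-norm `‖x‖ = ∑_t ‖x_t‖` on the path space, each `‖x_t‖` being Euclidean.
(This is not the sup norm that Mathlib puts on a function type.) -/
def pathNorm (x : PathSpace d T) : ℝ := ∑ t, ‖x t‖

/-- The initial segment of a path, consisting of its values strictly before `t`. -/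
def past (t : Fin T) (x : PathSpace d T) : PathSpace d t :=
  fun s => x (Fin.castLE t.isLt.le s)

/-- The regular conditional law, under `μ`, of `x_t` given the values before `t`. -/
def nextKernel (μ : Measure (PathSpace d T)) [IsFiniteMeasure μ] (t : Fin T) :
    Kernel (PathSpace d t) (EuclideanSpace ℝ (Fin d)) :=
  condDistrib (fun x : PathSpace d T => x t) (past t) μ

/-- The regular conditional law, under `π`, of `(x_t, y_t)` given the values of both paths
before `t`. -/
def jointNextKernel (π : Measure (PathSpace d T × PathSpace d T)) [IsFiniteMeasure π]
    (t : Fin T) :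
    Kernel (PathSpace d t × PathSpace d t)
      (EuclideanSpace ℝ (Fin d) × EuclideanSpace ℝ (Fin d)) :=
  condDistrib (fun z : PathSpace d T × PathSpace d T => (z.1 t, z.2 t))
    (fun z => (past t z.1, past t z.2)) π

/-- `π` is a coupling of `μ` and `ν`: its first marginal is `μ` and its second marginal is `ν`. -/
def IsCoupling {α β : Type*} [MeasurableSpace α] [MeasurableSpace β]
    (π : Measure (α × β)) (μ : Measure α) (ν : Measure β) : Prop :=
  π.map Prod.fst = μ ∧ π.map Prod.snd = ν

/-- `π` is a bi-causal coupling of `μ` and `ν`: a coupling such that, for every `t`, the conditional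
law of `(x_t, y_t)` given both pasts is almost surely a coupling of the conditional law of `x_t`
given the past of `x` under `μ` and of the conditional law of `y_t` given the past of `y` under `ν`.
(At the first time the pasts are trivial, and this only repeats that `π` is a coupling.) -/
def IsBicausalCoupling (π : Measure (PathSpace d T × PathSpace d T)) [IsFiniteMeasure π]
    (μ ν : Measure (PathSpace d T)) [IsFiniteMeasure μ] [IsFiniteMeasure ν] : Prop :=
  IsCoupling π μ ν ∧
    ∀ t : Fin T, ∀ᵐ z ∂π,
      IsCoupling (jointNextKernel π t (past t z.1, past t z.2))
        (nextKernel μ t (past t z.1)) (nextKernel ν t (past t z.2))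

/-- The first order adapted Wasserstein distance: the infimum of `∫ ‖x - y‖ dπ` over the bi-causal
couplings `π` of `μ` and `ν`, with values in `[0, ∞]`. -/
def adaptedWasserstein (μ ν : Measure (PathSpace d T)) [IsFiniteMeasure μ] [IsFiniteMeasure ν] :
    ℝ≥0∞ :=
  ⨅ (π : ProbabilityMeasure (PathSpace d T × PathSpace d T))
    (_ : IsBicausalCoupling (π : Measure (PathSpace d T × PathSpace d T)) μ ν),
    ∫⁻ z, ENNReal.ofReal (pathNorm (z.1 - z.2)) ∂(π : Measure (PathSpace d T × PathSpace d T))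

/-- The Gaussian law `𝒩(0, σ² I_{dT})` on the path space, as the law of a path whose `dT` real
coordinates are independent with law `𝒩(0, σ²)`. -/
def gaussianNoise (d T : ℕ) (σ : ℝ) : Measure (PathSpace d T) :=
  Measure.pi fun _ : Fin T =>
    (Measure.pi fun _ : Fin d => gaussianReal 0 (σ ^ 2).toNNReal).map (WithLp.toLp 2)

instance (d T : ℕ) (σ : ℝ) : IsProbabilityMeasure (gaussianNoise d T σ) := by
  have h : IsProbabilityMeasure
      ((Measure.pi fun _ : Fin d => gaussianReal 0 (σ ^ 2).toNNReal).map
        (WithLp.toLp 2 : (Fin d → ℝ) → EuclideanSpace ℝ (Fin d))) :=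
    Measure.isProbabilityMeasure_map (by fun_prop)
  unfold gaussianNoise
  infer_instance

/-- The smoothed adapted Wasserstein distance `𝒜𝒲₁(μ ∗ 𝒩_σ, ν ∗ 𝒩_σ)`. -/
def smoothAdaptedWasserstein (σ : ℝ) (μ ν : Measure (PathSpace d T))
    [IsFiniteMeasure μ] [IsFiniteMeasure ν] : ℝ≥0∞ :=
  adaptedWasserstein (μ.conv (gaussianNoise d T σ)) (ν.conv (gaussianNoise d T σ))

/-- The empirical measure `(1/N) ∑_{n < N} δ_{x_n}` of the first `N` points of a sequence
(the zero measure for `N = 0`). -/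
def empiricalMeasure {α : Type*} [MeasurableSpace α] (x : ℕ → α) (N : ℕ) : Measure α :=
  (N : ℝ≥0∞)⁻¹ • ∑ n ∈ Finset.range N, Measure.dirac (x n)

instance {α : Type*} [MeasurableSpace α] (x : ℕ → α) (N : ℕ) :
    IsFiniteMeasure (empiricalMeasure x N) := by
  unfold empiricalMeasure
  rcases Nat.eq_zero_or_pos N with rfl | hN
  · simp only [Finset.range_zero, Finset.sum_empty, smul_zero]
    infer_instance
  · exact Measure.smul_finite _ (by simp [hN.ne'])

end

/-! ### Maximal couplings depending measurably on a parameter. -/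

section MaximalCoupling

variable {α E : Type*} [MeasurableSpace α] [MeasurableSpace E] [StandardBorelSpace E]

/-- Two Markov kernels split into a common part and two residual parts; the residual part of the
first one lives on a measurable set which carries no residual part of the second one. -/
theorem exists_kernel_common_part (κ η : Kernel α E) [IsMarkovKernel κ] [IsMarkovKernel η] :
    ∃ (m r s : Kernel α E) (B : Set (α × E)), IsFiniteKernel m ∧ IsFiniteKernel r ∧
      IsFiniteKernel s ∧ MeasurableSet B ∧ m + r = κ ∧ m + s = η ∧
      ∀ a, r a (Prod.mk a ⁻¹' B)ᶜ = 0 ∧ s a (Prod.mk a ⁻¹' B) = 0 := by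
  set ρ : Kernel α E := κ + η
  have : IsFiniteKernel ρ := inferInstanceAs (IsFiniteKernel (κ + η))
  have : IsSFiniteKernel ρ := inferInstance
  have hf := Kernel.measurable_rnDeriv κ ρ
  have hg := Kernel.measurable_rnDeriv η ρ
  set f := Kernel.rnDeriv κ ρ
  set g := Kernel.rnDeriv η ρ
  have hκ : ρ.withDensity f = κ := by
    ext1 a
    exact Kernel.withDensity_rnDeriv_eq (Measure.AbsolutelyContinuous.rfl.add_right _)
  have hη : ρ.withDensity g = η := by
    ext1 a
    refine Kernel.withDensity_rnDeriv_eq ?_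
    change η a ≪ κ a + η a
    rw [add_comm]
    exact Measure.AbsolutelyContinuous.rfl.add_right _
  have hf' : Measurable (Function.uncurry f) := hf
  have hg' : Measurable (Function.uncurry g) := hg
  have hm : Measurable (Function.uncurry fun a x => min (f a x) (g a x)) := hf.min hg
  have hr : Measurable (Function.uncurry fun a x => f a x - min (f a x) (g a x)) := hf.sub hm
  have hs : Measurable (Function.uncurry fun a x => g a x - min (f a x) (g a x)) := hg.sub hm
  have hmr : ρ.withDensity (fun a x => min (f a x) (g a x)) +
      ρ.withDensity (fun a x => f a x - min (f a x) (g a x)) = κ := by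
    rw [add_comm, Kernel.withDensity_sub_add_cancel hf' hm, hκ]
    exact fun a => ae_of_all _ fun x => min_le_left _ _
  have hms : ρ.withDensity (fun a x => min (f a x) (g a x)) +
      ρ.withDensity (fun a x => g a x - min (f a x) (g a x)) = η := by
    rw [add_comm, Kernel.withDensity_sub_add_cancel hg' hm, hη]
    exact fun a => ae_of_all _ fun x => min_le_right _ _
  -- `B` is where the first density is strictly larger: off it `f - min f g` vanishes, on it `g -
  -- min f g` does. Joint measurability in `(a, x)` lets `B` serve later as an event for a sequence
  -- and its next value.
  have hB : MeasurableSet {p : α × E | g p.1 p.2 < f p.1 p.2} := measurableSet_lt hg hf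
  have hfin (κ' m' r' : Kernel α E) [IsMarkovKernel κ'] (h : m' + r' = κ') :
      IsFiniteKernel m' := by
    subst h
    exact ⟨1, by simp, fun a => by
      rw [← measure_univ (μ := (m' + r') a)]; exact Measure.le_add_right le_rfl _⟩
  refine ⟨_, _, _, _, ?_, ?_, ?_, hB, hmr, hms, fun a => ⟨?_, ?_⟩⟩
  · exact hfin _ _ _ hmr
  · exact hfin _ _ _ ((add_comm _ _).trans hmr)
  · exact hfin _ _ _ ((add_comm _ _).trans hms)
  · rw [Kernel.withDensity_apply' _ hr]
    refine (setLIntegral_congr_fun (g := fun _ => 0) (measurable_prodMk_left hB).compl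
      fun x hx => ?_).trans lintegral_zero
    have : f a x ≤ g a x := not_lt.1 hx
    simp [this]
  · rw [Kernel.withDensity_apply' _ hs]
    refine (setLIntegral_congr_fun (g := fun _ => 0) (measurable_prodMk_left hB)
      fun x hx => ?_).trans lintegral_zero
    have : g a x < f a x := hx
    simp [this.le]

/-- Two Markov kernels admit a measurable family of maximal couplings. -/
theorem exists_maximal_coupling_kernel (κ η : Kernel α E) [IsMarkovKernel κ] [IsMarkovKernel η] :
    ∃ (K : Kernel α (E × E)) (B : Set (α × E)), MeasurableSet B ∧
      (∀ a, IsCoupling (K a) (κ a) (η a)) ∧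
      ∀ a, K a {p | p.1 ≠ p.2} + η a (Prod.mk a ⁻¹' B) ≤ κ a (Prod.mk a ⁻¹' B) := by
  obtain ⟨m, r, s, B, _, _, _, hB, hmr, hms, hrs⟩ := exists_kernel_common_part κ η
  have hκ (a : α) : m a + r a = κ a := by rw [← hmr]; rfl
  have hη (a : α) : m a + s a = η a := by rw [← hms]; rfl
  have hmass (a : α) : r a Set.univ = s a Set.univ := by
    have h1 : m a Set.univ + r a Set.univ = 1 := by
      rw [← Measure.add_apply, hκ, measure_univ]
    have h2 : m a Set.univ + s a Set.univ = 1 := by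
      rw [← Measure.add_apply, hη, measure_univ]
    exact (ENNReal.add_right_inj (measure_ne_top _ _)).1 (h1.trans h2.symm)
  -- The common part goes to the diagonal, the residuals are coupled independently. If the residual
  -- mass is `0`, the normalisation is `∞` but multiplies the zero measure.
  have hc : Measurable (Function.uncurry fun (a : α) (_ : E × E) => (r a Set.univ)⁻¹) :=
    (Kernel.measurable_coe r MeasurableSet.univ).inv.comp measurable_fst
  have hd : Measurable fun x : E => (x, x) := measurable_id.prodMk measurable_id
  have hK (a : α) : (m.map (fun x : E => (x, x)) +
      (r ×ₖ s).withDensity fun a _ => (r a Set.univ)⁻¹) a =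
      (m a).map (fun x : E => (x, x)) + (r a Set.univ)⁻¹ • (r a).prod (s a) := by
    rw [add_apply, Kernel.map_apply _ hd, Kernel.withDensity_apply _ hc, Kernel.prod_apply,
      withDensity_const]
  refine ⟨m.map (fun x : E => (x, x)) + (r ×ₖ s).withDensity fun a _ => (r a Set.univ)⁻¹, B, hB,
    fun a => ?_, fun a => ?_⟩
  · rw [hK]
    constructor
    · rw [Measure.map_add _ _ measurable_fst, Measure.map_map measurable_fst hd, Measure.map_smul,
        Measure.map_fst_prod, ← hκ, ← hmass, smul_smul]
      congr 1
      · exact Measure.map_id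
      · by_cases h : r a Set.univ = 0
        · rw [Measure.measure_univ_eq_zero.1 h, smul_zero]
        · rw [ENNReal.inv_mul_cancel h (measure_ne_top _ _), one_smul]
    · rw [Measure.map_add _ _ measurable_snd, Measure.map_map measurable_snd hd, Measure.map_smul,
        Measure.map_snd_prod, ← hη, smul_smul]
      congr 1
      · exact Measure.map_id
      · by_cases h : r a Set.univ = 0
        · rw [Measure.measure_univ_eq_zero.1 ((hmass a).symm.trans h), smul_zero]
        · rw [ENNReal.inv_mul_cancel h (measure_ne_top _ _), one_smul]
  · have hne : MeasurableSet {p : E × E | p.1 ≠ p.2} := measurableSet_diagonal.compl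
    have hoff : ((m a).map fun x : E => (x, x)) {p | p.1 ≠ p.2} = 0 := by
      rw [Measure.map_apply hd hne]; simp
    have hle : (r a Set.univ)⁻¹ * (r a).prod (s a) {p | p.1 ≠ p.2} ≤ r a Set.univ := by
      calc _ ≤ (r a Set.univ)⁻¹ * (r a Set.univ * r a Set.univ) := by
            gcongr
            refine (measure_mono (Set.subset_univ _)).trans ?_
            rw [Measure.prod_apply MeasurableSet.univ]
            simp [hmass]
        _ ≤ r a Set.univ := by
            rw [← mul_assoc]
            exact mul_le_of_le_one_left (by positivity) (ENNReal.inv_mul_le_one _)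
    have hrB : r a Set.univ = r a (Prod.mk a ⁻¹' B) := by
      rw [← measure_add_measure_compl (measurable_prodMk_left hB), (hrs a).1, add_zero]
    rw [hK, Measure.add_apply, hoff, zero_add, Measure.smul_apply, smul_eq_mul, ← hη, ← hκ,
      Measure.add_apply, Measure.add_apply, (hrs a).2, add_zero, add_comm]
    gcongr
    exact hle.trans hrB.le

end MaximalCoupling

/-! ### Truncating and extending finite sequences. -/

section InitialSegment

variable {E : Type*}

/-- The initial segment of length `n`. -/
def initSeg {n m : ℕ} (h : n ≤ m) (x : Fin m → E) : Fin n → E := fun i => x (Fin.castLE h i)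

theorem initSeg_snoc {n m : ℕ} (h : n ≤ m) (x : Fin m → E) (y : E) :
    initSeg (h.trans m.le_succ) (Fin.snoc (α := fun _ => E) x y) = initSeg h x := by
  funext i
  exact Fin.snoc_castSucc (α := fun _ => E) y x (Fin.castLE h i)

theorem initSeg_succ {n m : ℕ} (h : n < m) (x : Fin m → E) :
    initSeg (Nat.succ_le_of_lt h) x =
      Fin.snoc (α := fun _ => E) (initSeg h.le x) (x ⟨n, h⟩) := by
  funext i
  induction i using Fin.lastCases with
  | last => rw [Fin.snoc_last]; rfl
  | cast i => rw [Fin.snoc_castSucc]; rfl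

end InitialSegment

/-! ### Pairs of sequences generated by successive kernels. -/

section SequentialCoupling

variable {E : Type*} [MeasurableSpace E]

/-- Append to both components of a pair of finite sequences. -/
def snocPair (n : ℕ) (p : ((Fin n → E) × (Fin n → E)) × (E × E)) :
    (Fin (n + 1) → E) × (Fin (n + 1) → E) :=
  (Fin.snoc (α := fun _ => E) p.1.1 p.2.1, Fin.snoc (α := fun _ => E) p.1.2 p.2.2)

theorem measurable_finSnoc (n : ℕ) :
    Measurable fun p : (Fin n → E) × E => Fin.snoc (α := fun _ => E) p.1 p.2 := by
  refine measurable_pi_iff.2 fun i => ?_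
  induction i using Fin.lastCases with
  | last => simpa using measurable_snd
  | cast i => simpa using measurable_fst.eval

theorem measurable_snocPair (n : ℕ) : Measurable (snocPair (E := E) n) :=
  ((measurable_finSnoc n).comp (g := fun p => Fin.snoc (α := fun _ => E) p.1 p.2)
    (f := fun p : ((Fin n → E) × (Fin n → E)) × (E × E) => (p.1.1, p.2.1)) (by fun_prop)).prodMk
  ((measurable_finSnoc n).comp (g := fun p => Fin.snoc (α := fun _ => E) p.1 p.2)
    (f := fun p : ((Fin n → E) × (Fin n → E)) × (E × E) => (p.1.2, p.2.2)) (by fun_prop))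

/-- The law of a pair of sequences of length `n` generated step by step by the kernels `K`. -/
noncomputable def sequentialLaw (K : ∀ n, Kernel ((Fin n → E) × (Fin n → E)) (E × E)) :
    ∀ n, Measure ((Fin n → E) × (Fin n → E))
  | 0 => Measure.dirac (Fin.elim0, Fin.elim0)
  | n + 1 => (sequentialLaw K n ⊗ₘ K n).map (snocPair n)

variable (K : ∀ n, Kernel ((Fin n → E) × (Fin n → E)) (E × E)) [∀ n, IsMarkovKernel (K n)]

instance isProbabilityMeasure_sequentialLaw (n : ℕ) :
    IsProbabilityMeasure (sequentialLaw K n) := by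
  induction n with
  | zero => exact Measure.dirac.isProbabilityMeasure
  | succ n ih => exact Measure.isProbabilityMeasure_map (measurable_snocPair n).aemeasurable

theorem measurable_initSeg {n m : ℕ} (h : n ≤ m) : Measurable (initSeg (E := E) h) :=
  measurable_pi_iff.2 fun _ => measurable_pi_apply _

/-- Each step kernel has mass one, so forgetting the last step restores the law before it. -/
theorem map_initSeg_sequentialLaw {n m : ℕ} (h : n ≤ m) :
    (sequentialLaw K m).map (Prod.map (initSeg h) (initSeg h)) = sequentialLaw K n := by
  induction m, h using Nat.le_induction with
  | base => exact Measure.map_id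
  | succ m h ih =>
    have hfst : (sequentialLaw K m ⊗ₘ K m).map Prod.fst = sequentialLaw K m :=
      Measure.fst_compProd _ _
    rw [sequentialLaw, Measure.map_map
      ((measurable_initSeg _).prodMap (measurable_initSeg _)) (measurable_snocPair m), ← ih]
    conv_rhs => rw [← hfst]
    rw [Measure.map_map ((measurable_initSeg _).prodMap (measurable_initSeg _)) measurable_fst]
    congr 1
    funext p
    simp only [Function.comp, snocPair, Prod.map]
    rw [initSeg_snoc h, initSeg_snoc h]

/-- Under the sequential law, the kernel `K n` generates the `n`-th step. -/
theorem map_step_sequentialLaw {n m : ℕ} (h : n < m) :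
    (sequentialLaw K m).map (fun z => ((initSeg h.le z.1, initSeg h.le z.2),
      (z.1 ⟨n, h⟩, z.2 ⟨n, h⟩))) = sequentialLaw K n ⊗ₘ K n := by
  have hg : Measurable fun w : (Fin (n + 1) → E) × (Fin (n + 1) → E) =>
      ((initSeg n.le_succ w.1, initSeg n.le_succ w.2), (w.1 (Fin.last n), w.2 (Fin.last n))) := by
    have := measurable_initSeg (E := E) n.le_succ
    fun_prop
  have key : (sequentialLaw K (n + 1)).map (fun w =>
      ((initSeg n.le_succ w.1, initSeg n.le_succ w.2), (w.1 (Fin.last n), w.2 (Fin.last n)))) =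
      sequentialLaw K n ⊗ₘ K n := by
    rw [sequentialLaw, Measure.map_map hg (measurable_snocPair n)]
    convert! Measure.map_id
    funext p
    have h1 (x : Fin n → E) (y : E) :
        initSeg n.le_succ (Fin.snoc (α := fun _ => E) x y) = x := initSeg_snoc le_rfl x y
    simp [snocPair, h1]
  rw [← key, ← map_initSeg_sequentialLaw K (Nat.succ_le_of_lt h), Measure.map_map hg
    ((measurable_initSeg _).prodMap (measurable_initSeg _))]
  rfl

variable [MeasurableEq E]

theorem measurableSet_pair_ne (n : ℕ) :
    MeasurableSet {z : (Fin n → E) × (Fin n → E) | z.1 ≠ z.2} := by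
  have : {z : (Fin n → E) × (Fin n → E) | z.1 ≠ z.2} = ⋃ i, {z | z.1 i = z.2 i}ᶜ := by
    ext z; simp [Function.ne_iff]
  rw [this]
  exact .iUnion fun i => (measurableSet_eq_fun (by fun_prop) (by fun_prop)).compl

/-- The two sequences separate at step `n` only if they agreed so far. -/
theorem sequentialLaw_succ_ne_le (n : ℕ) :
    sequentialLaw K (n + 1) {z | z.1 ≠ z.2} ≤ sequentialLaw K n {z | z.1 ≠ z.2} +
      ∫⁻ z, {z | z.1 = z.2}.indicator (fun z => K n z {p | p.1 ≠ p.2}) z ∂sequentialLaw K n := by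
  have hne := measurableSet_pair_ne (E := E) n
  have hE : MeasurableSet {p : E × E | p.1 ≠ p.2} := measurableSet_diagonal.compl
  have heq : MeasurableSet {z : (Fin n → E) × (Fin n → E) | z.1 = z.2} := by
    simpa [Set.compl_def] using hne.compl
  rw [sequentialLaw, Measure.map_apply (measurable_snocPair n) (measurableSet_pair_ne _)]
  have hsub : snocPair n ⁻¹' {z : (Fin (n + 1) → E) × (Fin (n + 1) → E) | z.1 ≠ z.2} ⊆
      {z | z.1 ≠ z.2} ×ˢ Set.univ ∪ {z | z.1 = z.2} ×ˢ {p : E × E | p.1 ≠ p.2} := by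
    rintro ⟨⟨a, b⟩, x, y⟩ h
    by_cases hab : a = b
    · refine Or.inr ⟨hab, fun hxy : x = y => h ?_⟩
      simp [snocPair, hab, hxy]
    · exact Or.inl ⟨hab, trivial⟩
  refine (measure_mono hsub).trans ((measure_union_le _ _).trans ?_)
  rw [Measure.compProd_apply_prod hne .univ, Measure.compProd_apply_prod heq hE,
    lintegral_indicator heq]
  simp

end SequentialCoupling

/-! ### From total variation to bi-causal couplings. -/

section BicausalCoupling

variable {d T : ℕ}

/-- Disintegration over the past. The recursion has the shape of `sequentialLaw`, so the marginals
there can be identified by induction. -/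
theorem map_initSeg_succ (μ : Measure (PathSpace d T)) [IsFiniteMeasure μ] {n : ℕ} (h : n < T) :
    μ.map (initSeg (Nat.succ_le_of_lt h)) =
      (μ.map (initSeg h.le) ⊗ₘ nextKernel μ ⟨n, h⟩).map
        (fun p => Fin.snoc (α := fun _ => EuclideanSpace ℝ (Fin d)) p.1 p.2) := by
  have hpast : past (⟨n, h⟩ : Fin T) = initSeg (E := EuclideanSpace ℝ (Fin d)) h.le := rfl
  have hm := measurable_initSeg (E := EuclideanSpace ℝ (Fin d)) h.le
  rw [nextKernel, hpast, compProd_map_condDistrib (measurable_pi_apply _).aemeasurable,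
    Measure.map_map (measurable_finSnoc n) (hm.prodMk (measurable_pi_apply _))]
  congr 1
  funext x
  exact initSeg_succ h x

/-- If two laws are close in total variation then so are their conditional laws, on average. -/
theorem lintegral_nextKernel_le {μ ν ρ ρ' : Measure (PathSpace d T)} [IsProbabilityMeasure μ]
    [IsProbabilityMeasure ν] {ε : ℝ≥0∞} (h₁ : μ ≤ ν + ρ) (h₂ : ν ≤ μ + ρ')
    (hρ : ρ Set.univ ≤ ε) (hρ' : ρ' Set.univ ≤ ε) {n : ℕ} (h : n < T)
    {C : Set (PathSpace d n × EuclideanSpace ℝ (Fin d))} (hC : MeasurableSet C) :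
    ∫⁻ a, nextKernel μ ⟨n, h⟩ a (Prod.mk a ⁻¹' C) ∂μ.map (initSeg h.le) ≤
      ∫⁻ a, nextKernel ν ⟨n, h⟩ a (Prod.mk a ⁻¹' C) ∂μ.map (initSeg h.le) + 2 * ε := by
  have hm := measurable_initSeg (E := EuclideanSpace ℝ (Fin d)) h.le
  have hpast : past (⟨n, h⟩ : Fin T) = initSeg (E := EuclideanSpace ℝ (Fin d)) h.le := rfl
  have hjoint (θ : Measure (PathSpace d T)) [IsProbabilityMeasure θ] :
      ∫⁻ a, nextKernel θ ⟨n, h⟩ a (Prod.mk a ⁻¹' C) ∂θ.map (initSeg h.le) =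
        θ ((fun x => (initSeg h.le x, x ⟨n, h⟩)) ⁻¹' C) := by
    have : IsProbabilityMeasure (θ.map (initSeg h.le)) :=
      Measure.isProbabilityMeasure_map hm.aemeasurable
    have : IsMarkovKernel (nextKernel θ ⟨n, h⟩) := by unfold nextKernel; infer_instance
    rw [← Measure.compProd_apply hC, nextKernel, hpast,
      compProd_map_condDistrib (measurable_pi_apply _).aemeasurable,
      Measure.map_apply (hm.prodMk (measurable_pi_apply _)) hC]
  have : IsMarkovKernel (nextKernel ν ⟨n, h⟩) := by unfold nextKernel; infer_instance
  calc ∫⁻ a, nextKernel μ ⟨n, h⟩ a (Prod.mk a ⁻¹' C) ∂μ.map (initSeg h.le)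
      = μ ((fun x => (initSeg h.le x, x ⟨n, h⟩)) ⁻¹' C) := hjoint μ
    _ ≤ ν ((fun x => (initSeg h.le x, x ⟨n, h⟩)) ⁻¹' C) + ε :=
        (h₁ _).trans (add_le_add le_rfl ((measure_mono (Set.subset_univ _)).trans hρ))
    _ = ∫⁻ a, nextKernel ν ⟨n, h⟩ a (Prod.mk a ⁻¹' C) ∂ν.map (initSeg h.le) + ε := by
        rw [hjoint ν]
    -- The first `ε` paid for replacing the joint law of past and next value; the second pays for
    -- returning to the past of `μ` while keeping the kernel of `ν`.
    _ ≤ ∫⁻ a, nextKernel ν ⟨n, h⟩ a (Prod.mk a ⁻¹' C) ∂(μ + ρ').map (initSeg h.le) + ε := by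
        gcongr
    _ ≤ ∫⁻ a, nextKernel ν ⟨n, h⟩ a (Prod.mk a ⁻¹' C) ∂μ.map (initSeg h.le) + ε + ε := by
        rw [Measure.map_add _ _ hm, lintegral_add_measure]
        gcongr
        calc _ ≤ ∫⁻ _, 1 ∂ρ'.map (initSeg h.le) := lintegral_mono fun _ => prob_le_one
          _ = ρ' Set.univ := by rw [lintegral_one, Measure.map_apply hm .univ, Set.preimage_univ]
          _ ≤ ε := hρ'
    _ = _ := by rw [add_assoc, two_mul]

/-- The disagreement bound is needed only at equal pasts, since pasts that already differ are
counted at earlier steps. It is additive to avoid truncated subtraction. -/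
theorem exists_step_kernel (μ ν : Measure (PathSpace d T)) [IsProbabilityMeasure μ]
    [IsProbabilityMeasure ν] (n : ℕ) :
    ∃ K : Kernel (PathSpace d n × PathSpace d n)
        (EuclideanSpace ℝ (Fin d) × EuclideanSpace ℝ (Fin d)),
      IsMarkovKernel K ∧ ∀ h : n < T,
        (∀ z, IsCoupling (K z) (nextKernel μ ⟨n, h⟩ z.1) (nextKernel ν ⟨n, h⟩ z.2)) ∧
        ∃ C : Set (PathSpace d n × EuclideanSpace ℝ (Fin d)), MeasurableSet C ∧
          ∀ a, K (a, a) {p | p.1 ≠ p.2} + nextKernel ν ⟨n, h⟩ a (Prod.mk a ⁻¹' C) ≤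
            nextKernel μ ⟨n, h⟩ a (Prod.mk a ⁻¹' C) := by
  by_cases h : n < T
  · have h1 : IsMarkovKernel (nextKernel μ ⟨n, h⟩) := by unfold nextKernel; infer_instance
    have h2 : IsMarkovKernel (nextKernel ν ⟨n, h⟩) := by unfold nextKernel; infer_instance
    obtain ⟨K, B, hB, hK, hKB⟩ := exists_maximal_coupling_kernel
      ((nextKernel μ ⟨n, h⟩).comap
        (Prod.fst : PathSpace d n × PathSpace d n → PathSpace d n) measurable_fst)
      ((nextKernel ν ⟨n, h⟩).comap
        (Prod.snd : PathSpace d n × PathSpace d n → PathSpace d n) measurable_snd)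
    refine ⟨K, ⟨fun z => ⟨?_⟩⟩, fun _ => ⟨hK, (fun p => ((p.1, p.1), p.2)) ⁻¹' B,
      hB.preimage (by fun_prop), fun a => hKB (a, a)⟩⟩
    have := congrArg (fun m : Measure _ => m Set.univ) (hK z).1
    simpa [Measure.map_apply measurable_fst] using this
  -- Beyond the horizon any Markov kernel will do; it only makes the family total on `ℕ`.
  · exact ⟨Kernel.const _ (Measure.dirac (0, 0)), inferInstance, fun h' => absurd h' h⟩

/-- Two laws on the path space which are close in total variation admit a bi-causal coupling
under which the two paths agree with high probability. -/
theorem exists_bicausalCoupling_ne_le {μ ν ρ ρ' : Measure (PathSpace d T)}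
    [IsProbabilityMeasure μ] [IsProbabilityMeasure ν] {ε : ℝ≥0∞} (h₁ : μ ≤ ν + ρ)
    (h₂ : ν ≤ μ + ρ') (hρ : ρ Set.univ ≤ ε) (hρ' : ρ' Set.univ ≤ ε) :
    ∃ π : ProbabilityMeasure (PathSpace d T × PathSpace d T),
      IsBicausalCoupling (π : Measure (PathSpace d T × PathSpace d T)) μ ν ∧
      (π : Measure (PathSpace d T × PathSpace d T)) {z | z.1 ≠ z.2} ≤ T * (2 * ε) := by
  choose K hKm hK using exists_step_kernel μ ν
  have hmk (θ : Measure (PathSpace d T)) [IsProbabilityMeasure θ] (t : Fin T) :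
      IsMarkovKernel (nextKernel θ t) := by unfold nextKernel; infer_instance
  have hm {n : ℕ} (h : n ≤ T) := measurable_initSeg (E := EuclideanSpace ℝ (Fin d)) h
  have hpm (θ : Measure (PathSpace d T)) [IsProbabilityMeasure θ] {n : ℕ} (h : n ≤ T) :
      IsProbabilityMeasure (θ.map (initSeg h)) :=
    Measure.isProbabilityMeasure_map (hm h).aemeasurable
  have hzero {S : Type} [MeasurableSpace S] (θ : Measure S) [IsProbabilityMeasure θ]
      (f : S → PathSpace d 0) (hf : Measurable f) : θ.map f = Measure.dirac Fin.elim0 := by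
    have : f = fun _ => Fin.elim0 := Subsingleton.elim _ _
    rw [this, Measure.map_const, measure_univ, one_smul]
  -- Causality enters here: given both pasts, the next `x` has a law depending on the past of `x`
  -- alone, so the first marginal follows its own recursion.
  have hfst : ∀ n (h : n ≤ T), (sequentialLaw K n).map Prod.fst = μ.map (initSeg h) := by
    intro n
    induction n with
    | zero => intro h; rw [hzero _ _ measurable_fst, hzero _ _ (hm h)]
    | succ n ih =>
      intro h
      have := hpm μ (Nat.le_of_succ_le h)
      rw [map_initSeg_succ μ h, sequentialLaw, Measure.map_map measurable_fst
        (measurable_snocPair n), ← ih (Nat.le_of_succ_le h)]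
      have : (Prod.fst : (PathSpace d (n + 1) × PathSpace d (n + 1)) → _) ∘ snocPair n =
        (fun p => Fin.snoc (α := fun _ => EuclideanSpace ℝ (Fin d)) p.1 p.2) ∘
          Prod.map Prod.fst Prod.fst := rfl
      rw [this, ← Measure.map_map (measurable_finSnoc n) (measurable_fst.prodMap measurable_fst)]
      congr 1
      ext1 s hs
      rw [Measure.map_apply (measurable_fst.prodMap measurable_fst) hs, Measure.compProd_apply
        (hs.preimage (measurable_fst.prodMap measurable_fst)), Measure.compProd_apply hs,
        lintegral_map (Kernel.measurable_kernel_prodMk_left hs) measurable_fst]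
      refine lintegral_congr fun z => ?_
      rw [← ((hK n h).1 z).1, Measure.map_apply measurable_fst (measurable_prodMk_left hs)]
      rfl
  have hsnd : ∀ n (h : n ≤ T), (sequentialLaw K n).map Prod.snd = ν.map (initSeg h) := by
    intro n
    induction n with
    | zero => intro h; rw [hzero _ _ measurable_snd, hzero _ _ (hm h)]
    | succ n ih =>
      intro h
      have := hpm ν (Nat.le_of_succ_le h)
      rw [map_initSeg_succ ν h, sequentialLaw, Measure.map_map measurable_snd
        (measurable_snocPair n), ← ih (Nat.le_of_succ_le h)]
      have : (Prod.snd : (PathSpace d (n + 1) × PathSpace d (n + 1)) → _) ∘ snocPair n =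
        (fun p => Fin.snoc (α := fun _ => EuclideanSpace ℝ (Fin d)) p.1 p.2) ∘
          Prod.map Prod.snd Prod.snd := rfl
      rw [this, ← Measure.map_map (measurable_finSnoc n) (measurable_snd.prodMap measurable_snd)]
      congr 1
      ext1 s hs
      rw [Measure.map_apply (measurable_snd.prodMap measurable_snd) hs, Measure.compProd_apply
        (hs.preimage (measurable_snd.prodMap measurable_snd)), Measure.compProd_apply hs,
        lintegral_map (Kernel.measurable_kernel_prodMk_left hs) measurable_snd]
      refine lintegral_congr fun z => ?_
      rw [← ((hK n h).1 z).2, Measure.map_apply measurable_snd (measurable_prodMk_left hs)]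
      rfl
  have hbound : ∀ n, n ≤ T → sequentialLaw K n {z | z.1 ≠ z.2} ≤ n * (2 * ε) := by
    intro n
    induction n with
    | zero =>
      intro _
      have : {z : PathSpace d 0 × PathSpace d 0 | z.1 ≠ z.2} = ∅ := by
        ext z; simpa using Subsingleton.elim _ _
      rw [show {z : (Fin 0 → EuclideanSpace ℝ (Fin d)) × (Fin 0 → EuclideanSpace ℝ (Fin d)) |
        z.1 ≠ z.2} = ∅ from this]
      simp
    | succ n ih =>
      intro h
      obtain ⟨C, hC, hKC⟩ := (hK n h).2
      have := hpm μ (Nat.le_of_succ_le h)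
      have hdiag : Measurable fun a => K n (a, a) {p | p.1 ≠ p.2} :=
        (Kernel.measurable_coe (K n) measurableSet_diagonal.compl).comp
          (measurable_id.prodMk measurable_id)
      have hνm : Measurable fun a => nextKernel ν ⟨n, h⟩ a (Prod.mk a ⁻¹' C) :=
        Kernel.measurable_kernel_prodMk_left hC
      have hstep : ∫⁻ a, K n (a, a) {p | p.1 ≠ p.2} ∂μ.map (initSeg (Nat.le_of_succ_le h)) ≤
          2 * ε := by
        have hfin : ∫⁻ a, nextKernel ν ⟨n, h⟩ a (Prod.mk a ⁻¹' C)
            ∂μ.map (initSeg (Nat.le_of_succ_le h)) ≠ ∞ := by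
          refine ((lintegral_mono fun a => prob_le_one).trans_lt ?_).ne
          simp
        refine (ENNReal.add_le_add_iff_left hfin).1 ?_
        rw [← lintegral_add_left hνm]
        refine le_trans (lintegral_mono fun a => ?_) (lintegral_nextKernel_le h₁ h₂ hρ hρ' h hC)
        rw [add_comm]
        exact hKC a
      refine (sequentialLaw_succ_ne_le K n).trans ?_
      rw [Nat.cast_succ, add_mul, one_mul]
      gcongr
      · exact ih (Nat.le_of_succ_le h)
      · refine le_trans ?_ hstep
        -- On the diagonal the pair is determined by its first component, whose law is the past of
        -- `μ`; off it the indicator is zero.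
        rw [← hfst, lintegral_map hdiag measurable_fst]
        refine lintegral_mono fun z => ?_
        obtain ⟨a, b⟩ := z
        by_cases hab : a = b
        · subst hab; simp
        · simp [hab]
  refine ⟨⟨sequentialLaw K T, inferInstance⟩, ⟨⟨?_, ?_⟩, fun t => ?_⟩, hbound T le_rfl⟩
  · exact (hfst T le_rfl).trans Measure.map_id
  · exact (hsnd T le_rfl).trans Measure.map_id
  · have hpair : Measurable fun z : PathSpace d T × PathSpace d T => (past t z.1, past t z.2) :=
      ((hm t.isLt.le).comp measurable_fst).prodMk ((hm t.isLt.le).comp measurable_snd)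
    have hlaw : (sequentialLaw K T).map (fun z => (past t z.1, past t z.2)) =
        sequentialLaw K t := map_initSeg_sequentialLaw K t.isLt.le
    -- Conditional laws are almost everywhere unique, so the kernel used in the construction is a
    -- version of the one in the definition.
    have hcond : jointNextKernel (sequentialLaw K T) t =ᵐ[sequentialLaw K t] K t := by
      rw [← hlaw]
      refine condDistrib_ae_eq_of_measure_eq_compProd _ (by fun_prop) ?_
      rw [hlaw]
      exact map_step_sequentialLaw K t.isLt
    rw [← hlaw] at hcond
    filter_upwards [ae_of_ae_map hpair.aemeasurable hcond] with z hz
    change IsCoupling (jointNextKernel (sequentialLaw K T) t _) _ _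
    rw [hz]
    exact (hK t t.isLt).1 _

end BicausalCoupling

/-! ### The strong law for empirical integrals. -/

section EmpiricalMeasure

variable {S : Type*} [MeasurableSpace S]

theorem lintegral_empiricalMeasure (x : ℕ → S) (N : ℕ) {f : S → ℝ≥0∞} (hf : Measurable f) :
    ∫⁻ y, f y ∂empiricalMeasure x N = (N : ℝ≥0∞)⁻¹ * ∑ n ∈ Finset.range N, f (x n) := by
  rw [empiricalMeasure, lintegral_smul_measure, lintegral_finsetSum_measure, smul_eq_mul]
  simp only [lintegral_dirac' _ hf]

theorem isProbabilityMeasure_empiricalMeasure (x : ℕ → S) {N : ℕ} (hN : N ≠ 0) :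
    IsProbabilityMeasure (empiricalMeasure x N) := by
  refine ⟨?_⟩
  rw [← lintegral_one, lintegral_empiricalMeasure x N measurable_const]
  simp [ENNReal.inv_mul_cancel, hN]

/-- The strong law of large numbers for empirical integrals of nonnegative functions. -/
theorem ae_tendsto_lintegral_empiricalMeasure {μ : Measure S} {Ω : Type*} [MeasurableSpace Ω]
    {P : Measure Ω} {X : ℕ → Ω → S} (hX : ∀ n, Measurable (X n)) (hindep : iIndepFun X P)
    (hlaw : ∀ n, P.map (X n) = μ) {f : S → ℝ≥0∞} (hf : Measurable f)
    (hfi : ∫⁻ x, f x ∂μ ≠ ∞) :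
    ∀ᵐ ω ∂P, Tendsto (fun N => ∫⁻ x, f x ∂empiricalMeasure (fun n => X n ω) N) atTop
      (𝓝 (∫⁻ x, f x ∂μ)) := by
  have hint : Integrable (fun x => (f x).toReal) μ :=
    integrable_toReal_of_lintegral_ne_top hf.aemeasurable hfi
  -- Almost surely no sample hits `{f = ∞}`, so passing to `toReal` loses nothing.
  have hfin : ∀ᵐ ω ∂P, ∀ n, f (X n ω) < ∞ := by
    refine ae_all_iff.2 fun n => ae_of_ae_map (p := fun x => f x < ∞) (hX n).aemeasurable ?_
    rw [hlaw n]
    exact ae_lt_top hf hfi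
  have hsl := strong_law_ae_real (μ := P) (fun n ω => (f (X n ω)).toReal)
    (by
      rw [← hlaw 0] at hint
      exact hint.comp_measurable (hX 0))
    (fun i j hij => (hindep.indepFun hij).comp hf.ennreal_toReal hf.ennreal_toReal)
    (fun i => IdentDistrib.comp (u := fun x => (f x).toReal)
      ⟨(hX i).aemeasurable, (hX 0).aemeasurable, by rw [hlaw, hlaw]⟩ hf.ennreal_toReal)
  have hmean : ENNReal.ofReal (∫ ω, (f (X 0 ω)).toReal ∂P) = ∫⁻ x, f x ∂μ := by
    rw [← integral_map (f := fun x => (f x).toReal) (hX 0).aemeasurable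
      hf.ennreal_toReal.aestronglyMeasurable, hlaw,
      integral_toReal hf.aemeasurable (ae_lt_top hf hfi), ENNReal.ofReal_toReal hfi]
  filter_upwards [hfin, hsl] with ω hω hlim
  rw [← hmean]
  refine ((ENNReal.continuous_ofReal.tendsto _).comp hlim).congr' ?_
  filter_upwards [eventually_ne_atTop 0] with N hN
  rw [lintegral_empiricalMeasure _ _ hf, Function.comp_apply,
    ENNReal.ofReal_div_of_pos (by positivity), ENNReal.ofReal_sum_of_nonneg (by simp),
    ENNReal.ofReal_natCast, ENNReal.div_eq_inv_mul]
  simp only [ENNReal.ofReal_toReal (hω _).ne]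

end EmpiricalMeasure

/-! ### `L¹` convergence of densities and densities of convolutions. -/

section Densities

variable {S : Type*} [MeasurableSpace S]

/-- **Scheffé's lemma**: one sided form. -/
theorem tendsto_lintegral_sub_of_ae_tendsto {m : Measure S} {q : S → ℝ≥0∞} {p : ℕ → S → ℝ≥0∞}
    (hq : Measurable q) (hp : ∀ N, Measurable (p N)) (hqi : ∫⁻ x, q x ∂m ≠ ∞)
    (h : ∀ᵐ x ∂m, Tendsto (fun N => p N x) atTop (𝓝 (q x))) :
    Tendsto (fun N => ∫⁻ x, (q x - p N x) ∂m) atTop (𝓝 0) := by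
  -- The truncated difference is dominated by `q` itself, so nothing is required of the masses of `p
  -- N`.
  have := tendsto_lintegral_of_dominated_convergence (μ := m) (f := fun _ => 0)
    (F := fun N x => q x - p N x) q (fun N => hq.sub (hp N))
    (fun N => ae_of_all _ fun x => tsub_le_self) hqi (by
      filter_upwards [h, ae_lt_top hq hqi] with x hx hqx
      simpa using ENNReal.Tendsto.sub (tendsto_const_nhds (x := q x)) hx (Or.inl hqx.ne))
  simpa using this

theorem withDensity_le_add_withDensity_sub (m : Measure S) {p q : S → ℝ≥0∞}
    (hq : Measurable q) : m.withDensity p ≤ m.withDensity q + m.withDensity (fun x => p x - q x) := by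
  rw [← withDensity_add_left hq]
  exact withDensity_mono (ae_of_all _ fun x => le_add_tsub)

/-- Adding the common mass to either side gives the integral of `max p q`. This turns the one-sided
Scheffé lemma into a two-sided one. -/
theorem lintegral_sub_comm_of_lintegral_eq {m : Measure S} {p q : S → ℝ≥0∞} (hp : Measurable p)
    (hq : Measurable q) (h : ∫⁻ x, p x ∂m = ∫⁻ x, q x ∂m) (hqi : ∫⁻ x, q x ∂m ≠ ∞) :
    ∫⁻ x, (p x - q x) ∂m = ∫⁻ x, (q x - p x) ∂m := by
  have hpq : ∫⁻ x, (p x - q x) ∂m + ∫⁻ x, q x ∂m = ∫⁻ x, (q x - p x) ∂m + ∫⁻ x, p x ∂m := by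
    rw [← lintegral_add_right _ hq, ← lintegral_add_right _ hp]
    refine lintegral_congr fun x => ?_
    rw [tsub_add_eq_max, tsub_add_eq_max, max_comm]
  rw [h] at hpq
  exact (ENNReal.add_left_inj hqi).1 hpq

variable {G : Type*} [MeasurableSpace G] [AddCommGroup G] [MeasurableAdd₂ G] [MeasurableNeg G]

/-- Convolution with an absolutely continuous law is absolutely continuous, with an explicit
density. -/
theorem conv_withDensity_eq (m : Measure G) [SFinite m] [m.IsAddRightInvariant] (ρ : Measure G)
    [SFinite ρ] {g : G → ℝ≥0∞} (hg : Measurable g) :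
    ρ.conv (m.withDensity g) = m.withDensity fun x => ∫⁻ y, g (x - y) ∂ρ := by
  have hgs : Measurable fun p : G × G => g (p.2 - p.1) := by
    simp only [sub_eq_add_neg]; fun_prop
  ext s hs
  have : SFinite (m.withDensity g) := inferInstance
  rw [← lintegral_indicator_one hs, Measure.lintegral_conv (measurable_one.indicator hs),
    withDensity_apply _ hs, ← lintegral_indicator hs]
  have h1 (y : G) : ∫⁻ z, s.indicator 1 (y + z) ∂m.withDensity g =
      ∫⁻ x, s.indicator (fun x => g (x - y)) x ∂m := by
    rw [lintegral_withDensity_eq_lintegral_mul _ hg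
      (show Measurable fun z => s.indicator (1 : G → ℝ≥0∞) (y + z) from
        (measurable_one.indicator hs).comp (measurable_const_add y)),
      -- Translation invariance gives the substitution `x = z + y`; Tonelli then finishes.
      ← lintegral_add_right_eq_self (fun x => s.indicator (fun x => g (x - y)) x) y]
    refine lintegral_congr fun z => ?_
    by_cases hz : z + y ∈ s <;> simp [hz, Set.indicator, add_comm y z]
  simp_rw [h1]
  rw [lintegral_lintegral_swap]
  · refine lintegral_congr fun x => ?_
    by_cases hx : x ∈ s <;> simp [hx]
  · refine Measurable.aemeasurable ?_
    exact Measurable.indicator (s := Prod.snd ⁻¹' s) hgs (hs.preimage measurable_snd)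

end Densities

/-! ### Absolute continuity and first moment of the noise. -/

section GaussianNoise

theorem Measure.pi_absolutelyContinuous_fin {n : ℕ} {α : Type*} [MeasurableSpace α]
    {μ ν : Fin n → Measure α} [∀ i, SigmaFinite (μ i)] [∀ i, SigmaFinite (ν i)]
    (h : ∀ i, μ i ≪ ν i) : Measure.pi μ ≪ Measure.pi ν := by
  induction n with
  | zero => rw [Subsingleton.elim μ ν]
  | succ n ih =>
    have hμ := (measurePreserving_piFinSuccAbove μ 0).symm
    have hν := (measurePreserving_piFinSuccAbove ν 0).symm
    rw [← hμ.map_eq, ← hν.map_eq]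
    exact ((h 0).prod (ih fun i => h _)).map (MeasurableEquiv.measurable _)

theorem gaussianNoise_absolutelyContinuous (d T : ℕ) {σ : ℝ} (hσ : 0 < σ) :
    gaussianNoise d T σ ≪ volume := by
  have hv : (σ ^ 2).toNNReal ≠ 0 := by simpa using hσ.ne'
  have hcoord : (Measure.pi fun _ : Fin d => gaussianReal 0 (σ ^ 2).toNNReal).map
      (WithLp.toLp 2 : (Fin d → ℝ) → EuclideanSpace ℝ (Fin d)) ≪ volume := by
    rw [← (PiLp.volume_preserving_toLp (Fin d)).map_eq, volume_pi]
    exact (Measure.pi_absolutelyContinuous_fin fun _ =>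
      gaussianReal_absolutelyContinuous 0 hv).map (by fun_prop)
  have : IsProbabilityMeasure ((Measure.pi fun _ : Fin d => gaussianReal 0 (σ ^ 2).toNNReal).map
      (WithLp.toLp 2 : (Fin d → ℝ) → EuclideanSpace ℝ (Fin d))) :=
    Measure.isProbabilityMeasure_map (by fun_prop)
  rw [volume_pi]
  exact Measure.pi_absolutelyContinuous_fin fun _ => hcoord

theorem measurable_pathNorm {d T : ℕ} : Measurable (pathNorm (d := d) (T := T)) := by
  unfold pathNorm; fun_prop

/-- The Euclidean norm is at most the sum of the absolute coordinates, and each coordinate is a real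
Gaussian. -/
theorem lintegral_pathNorm_gaussianNoise_lt_top (d T : ℕ) (σ : ℝ) :
    ∫⁻ x, ENNReal.ofReal (pathNorm x) ∂gaussianNoise d T σ < ∞ := by
  have : IsProbabilityMeasure ((Measure.pi fun _ : Fin d => gaussianReal 0 (σ ^ 2).toNNReal).map
      (WithLp.toLp 2 : (Fin d → ℝ) → EuclideanSpace ℝ (Fin d))) :=
    Measure.isProbabilityMeasure_map (by fun_prop)
  have hreal : ∫⁻ r, ‖r‖ₑ ∂gaussianReal 0 (σ ^ 2).toNNReal < ∞ :=
    ((memLp_id_gaussianReal (μ := 0) (v := (σ ^ 2).toNNReal) 1).integrable le_rfl).2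
  have hle (x : PathSpace d T) : ENNReal.ofReal (pathNorm x) ≤ ∑ t, ∑ i, ‖x t i‖ₑ := by
    rw [pathNorm, ENNReal.ofReal_sum_of_nonneg fun _ _ => norm_nonneg _]
    refine Finset.sum_le_sum fun t _ => ?_
    rw [ofReal_norm]
    calc ‖x t‖ₑ = ‖∑ i, x t i • EuclideanSpace.basisFun (Fin d) ℝ i‖ₑ := by
          congr 1; exact ((EuclideanSpace.basisFun (Fin d) ℝ).sum_repr (x t)).symm
      _ ≤ ∑ i, ‖x t i • EuclideanSpace.basisFun (Fin d) ℝ i‖ₑ := enorm_sum_le _ _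
      _ = ∑ i, ‖x t i‖ₑ := by
          refine Finset.sum_congr rfl fun i _ => ?_
          rw [enorm_smul, ← ofReal_norm (EuclideanSpace.basisFun (Fin d) ℝ i),
            OrthonormalBasis.norm_eq_one, ENNReal.ofReal_one, mul_one]
  refine (lintegral_mono hle).trans_lt ?_
  rw [lintegral_finsetSum _ fun t _ => by fun_prop]
  refine ENNReal.sum_lt_top.2 fun t _ => ?_
  rw [lintegral_finsetSum _ fun t _ => by fun_prop]
  refine ENNReal.sum_lt_top.2 fun i _ => ?_
  have h1 := (measurePreserving_eval (fun _ : Fin T =>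
    (Measure.pi fun _ : Fin d => gaussianReal 0 (σ ^ 2).toNNReal).map
      (WithLp.toLp 2 : (Fin d → ℝ) → EuclideanSpace ℝ (Fin d))) t).lintegral_comp
    (f := fun y => ‖y i‖ₑ) (by fun_prop)
  have h2 := (measurePreserving_eval (fun _ : Fin d => gaussianReal 0 (σ ^ 2).toNNReal)
    i).lintegral_comp (f := fun r => ‖r‖ₑ) (by fun_prop)
  rw [gaussianNoise]
  refine (h1.trans ?_).trans_lt hreal
  rw [lintegral_map (by fun_prop) (by fun_prop), ← h2]

end GaussianNoise

/-! ### Tail truncation, the cost bound, and convergence in total variation. -/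

section Convergence

variable {d T : ℕ}

theorem pathNorm_nonneg (x : PathSpace d T) : 0 ≤ pathNorm x :=
  Finset.sum_nonneg fun _ _ => norm_nonneg _

theorem pathNorm_add_le (x y : PathSpace d T) : pathNorm (x + y) ≤ pathNorm x + pathNorm y := by
  rw [pathNorm, pathNorm, pathNorm, ← Finset.sum_add_distrib]
  exact Finset.sum_le_sum fun t _ => norm_add_le _ _

theorem pathNorm_sub_le (x y : PathSpace d T) : pathNorm (x - y) ≤ pathNorm x + pathNorm y := by
  rw [pathNorm, pathNorm, pathNorm, ← Finset.sum_add_distrib]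
  exact Finset.sum_le_sum fun t _ => norm_sub_le _ _

/-- The part of the path norm above the level `R`. -/
noncomputable def pathNormTail (R : ℝ) : PathSpace d T → ℝ≥0∞ :=
  {x | R < pathNorm x}.indicator fun x => ENNReal.ofReal (pathNorm x)

theorem measurable_pathNormTail (R : ℝ) : Measurable (pathNormTail (d := d) (T := T) R) :=
  measurable_pathNorm.ennreal_ofReal.indicator (measurableSet_lt measurable_const measurable_pathNorm)

theorem pathNormTail_le (R : ℝ) (x : PathSpace d T) :
    pathNormTail R x ≤ ENNReal.ofReal (pathNorm x) :=
  Set.indicator_le_self _ _ _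

theorem ofReal_pathNorm_le_add_tail (R : ℝ) (x : PathSpace d T) :
    ENNReal.ofReal (pathNorm x) ≤ ENNReal.ofReal R + pathNormTail R x := by
  by_cases h : R < pathNorm x
  · rw [pathNormTail, Set.indicator_of_mem (s := {x | R < pathNorm x}) h]
    exact le_add_self
  · exact (ENNReal.ofReal_le_ofReal (not_lt.1 h)).trans le_self_add

theorem tendsto_lintegral_pathNormTail {μ : Measure (PathSpace d T)}
    (hμ : ∫⁻ x, ENNReal.ofReal (pathNorm x) ∂μ ≠ ∞) :
    Tendsto (fun R : ℕ => ∫⁻ x, pathNormTail R x ∂μ) atTop (𝓝 0) := by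
  have := tendsto_lintegral_of_dominated_convergence (μ := μ) (f := fun _ => 0)
    (F := fun (R : ℕ) x => pathNormTail R x) _ (fun R => measurable_pathNormTail _)
    (fun R => ae_of_all _ fun x => pathNormTail_le _ x) hμ (by
      refine ae_of_all _ fun x => tendsto_const_nhds.congr' ?_
      filter_upwards [eventually_ge_atTop ⌈pathNorm x⌉₊] with R hR
      have : ¬ (R : ℝ) < pathNorm x := not_lt.2 (Nat.ceil_le.1 hR)
      simp [pathNormTail, this])
  simpa using this

/-- The adapted Wasserstein distance is controlled by the total variation distance and the tails
of the two laws. -/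
theorem adaptedWasserstein_le_of_le_add {μ ν ρ ρ' : Measure (PathSpace d T)}
    [IsProbabilityMeasure μ] [IsProbabilityMeasure ν] {ε : ℝ≥0∞} (h₁ : μ ≤ ν + ρ)
    (h₂ : ν ≤ μ + ρ') (hρ : ρ Set.univ ≤ ε) (hρ' : ρ' Set.univ ≤ ε) (R : ℝ) :
    adaptedWasserstein μ ν ≤ 2 * ENNReal.ofReal R * (T * (2 * ε)) +
      ∫⁻ x, pathNormTail R x ∂μ + ∫⁻ x, pathNormTail R x ∂ν := by
  obtain ⟨π, hπ, hne⟩ := exists_bicausalCoupling_ne_le h₁ h₂ hρ hρ'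
  have hmt := measurable_pathNormTail (d := d) (T := T) R
  have hmt₁ : Measurable fun z : PathSpace d T × PathSpace d T => pathNormTail R z.1 :=
    hmt.comp measurable_fst
  have hmt₂ : Measurable fun z : PathSpace d T × PathSpace d T => pathNormTail R z.2 :=
    hmt.comp measurable_snd
  have hE : MeasurableSet {z : PathSpace d T × PathSpace d T | z.1 ≠ z.2} :=
    measurableSet_pair_ne T
  refine (iInf₂_le π hπ).trans ?_
  calc ∫⁻ z, ENNReal.ofReal (pathNorm (z.1 - z.2)) ∂(π : Measure (PathSpace d T × PathSpace d T))
      ≤ ∫⁻ z, ({z | z.1 ≠ z.2}.indicator (fun _ => 2 * ENNReal.ofReal R) z +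
          pathNormTail R z.1 + pathNormTail R z.2)
          ∂(π : Measure (PathSpace d T × PathSpace d T)) := by
        refine lintegral_mono fun z => ?_
        -- Equal paths cost nothing; otherwise each path contributes at most `R` plus its tail.
        by_cases hz : z.1 = z.2
        · simp [hz, pathNorm]
        · rw [Set.indicator_of_mem (s := {z : PathSpace d T × PathSpace d T | z.1 ≠ z.2}) hz]
          calc ENNReal.ofReal (pathNorm (z.1 - z.2))
              ≤ ENNReal.ofReal (pathNorm z.1) + ENNReal.ofReal (pathNorm z.2) := by
                rw [← ENNReal.ofReal_add (pathNorm_nonneg _) (pathNorm_nonneg _)]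
                exact ENNReal.ofReal_le_ofReal (pathNorm_sub_le _ _)
            _ ≤ (ENNReal.ofReal R + pathNormTail R z.1) +
                (ENNReal.ofReal R + pathNormTail R z.2) :=
                add_le_add (ofReal_pathNorm_le_add_tail _ _) (ofReal_pathNorm_le_add_tail _ _)
            _ = _ := by ring
    _ = 2 * ENNReal.ofReal R * (π : Measure (PathSpace d T × PathSpace d T)) {z | z.1 ≠ z.2} +
          ∫⁻ x, pathNormTail R x ∂μ + ∫⁻ x, pathNormTail R x ∂ν := by
        rw [lintegral_add_right _ hmt₂, lintegral_add_right _ hmt₁, lintegral_indicator_const hE,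
          ← lintegral_map hmt measurable_fst, ← lintegral_map hmt measurable_snd, hπ.1.1, hπ.1.2]
    _ ≤ _ := by gcongr

theorem lintegral_eq_one_of_isProbabilityMeasure_withDensity {S : Type*} [MeasurableSpace S] {m : Measure S}
    {f : S → ℝ≥0∞} (h : IsProbabilityMeasure (m.withDensity f)) : ∫⁻ x, f x ∂m = 1 := by
  rw [← h.measure_univ, withDensity_apply _ .univ, Measure.restrict_univ]

/-- Almost surely, the smoothed empirical measures converge to the smoothed law in total
variation. -/
theorem ae_exists_tendsto_smooth_empiricalMeasure {μ : Measure (PathSpace d T)} [IsProbabilityMeasure μ] {Ω : Type*}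
    [MeasurableSpace Ω] {P : Measure Ω} [IsProbabilityMeasure P] {X : ℕ → Ω → PathSpace d T}
    (hX : ∀ n, Measurable (X n))
    (hindep : iIndepFun X P) (hlaw : ∀ n, P.map (X n) = μ) {γ : Measure (PathSpace d T)}
    [IsProbabilityMeasure γ] (hγ : γ ≪ volume) :
    ∀ᵐ ω ∂P, ∃ ε : ℕ → ℝ≥0∞, Tendsto ε atTop (𝓝 0) ∧ ∀ N ≠ 0,
      ∃ ρ ρ' : Measure (PathSpace d T),
        μ.conv γ ≤ (empiricalMeasure (fun n => X n ω) N).conv γ + ρ ∧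
        (empiricalMeasure (fun n => X n ω) N).conv γ ≤ μ.conv γ + ρ' ∧
        ρ Set.univ ≤ ε N ∧ ρ' Set.univ ≤ ε N := by
  obtain ⟨g, hg, rfl⟩ : ∃ g : PathSpace d T → ℝ≥0∞, Measurable g ∧ volume.withDensity g = γ :=
    ⟨_, Measure.measurable_rnDeriv γ volume, Measure.withDensity_rnDeriv_eq γ volume hγ⟩
  have hgs : Measurable fun p : PathSpace d T × PathSpace d T => g (p.1 - p.2) :=
    hg.comp (measurable_fst.sub measurable_snd)
  have hdens (θ : Measure (PathSpace d T)) [SFinite θ] :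
      Measurable fun x => ∫⁻ y, g (x - y) ∂θ := hgs.lintegral_prod_right'
  have hconv (θ : Measure (PathSpace d T)) [SFinite θ] :=
    conv_withDensity_eq volume θ hg
  have hmass (θ : Measure (PathSpace d T)) [IsProbabilityMeasure θ] :
      ∫⁻ x, ∫⁻ y, g (x - y) ∂θ = 1 := by
    apply lintegral_eq_one_of_isProbabilityMeasure_withDensity
    rw [← hconv θ]
    infer_instance
  have hfin : ∀ᵐ x : PathSpace d T, ∫⁻ y, g (x - y) ∂μ < ∞ :=
    ae_lt_top (hdens μ) (by rw [hmass μ]; exact ENNReal.one_ne_top)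
  have hemp (N : ℕ) : Measurable fun p : Ω × PathSpace d T =>
      ∫⁻ y, g (p.2 - y) ∂empiricalMeasure (fun n => X n p.1) N := by
    have : (fun p : Ω × PathSpace d T =>
        ∫⁻ y, g (p.2 - y) ∂empiricalMeasure (fun n => X n p.1) N) =
        fun p => (N : ℝ≥0∞)⁻¹ * ∑ n ∈ Finset.range N, g (p.2 - X n p.1) := by
      funext p
      exact lintegral_empiricalMeasure _ _ (hgs.comp measurable_prodMk_left)
    rw [this]
    refine (Finset.measurable_sum _ fun n _ => ?_).const_mul _
    exact hg.comp (measurable_snd.sub ((hX n).comp measurable_fst))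
  have hae : ∀ᵐ ω ∂P, ∀ᵐ x : PathSpace d T,
      Tendsto (fun N => ∫⁻ y, g (x - y) ∂empiricalMeasure (fun n => X n ω) N) atTop
        (𝓝 (∫⁻ y, g (x - y) ∂μ)) := by
    -- The null set in the strong law depends on `x`. Joint measurability of the convergence set
    -- allows the two "almost every" to be exchanged.
    refine (Measure.ae_ae_comm ?_).2 ?_
    · exact measurableSet_tendsto_fun hemp ((hdens μ).comp measurable_snd)
    · filter_upwards [hfin] with x hx
      exact ae_tendsto_lintegral_empiricalMeasure hX hindep hlaw
        (hgs.comp measurable_prodMk_left) hx.ne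
  filter_upwards [hae] with ω hω
  -- `ε N` is the integral of the positive part of limit density minus empirical density. The
  -- opposite excess has the same mass because both densities integrate to one, which requires `N ≠
  -- 0`.
  refine ⟨_, tendsto_lintegral_sub_of_ae_tendsto (hdens μ) (fun N => hdens _)
    (by rw [hmass μ]; exact ENNReal.one_ne_top) hω, fun N hN => ?_⟩
  have := isProbabilityMeasure_empiricalMeasure (fun n => X n ω) hN
  rw [hconv, hconv]
  refine ⟨_, _, withDensity_le_add_withDensity_sub _ (hdens _),
    withDensity_le_add_withDensity_sub _ (hdens _), ?_, ?_⟩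
  · simp
  · rw [withDensity_apply _ .univ, Measure.restrict_univ]
    refine (lintegral_sub_comm_of_lintegral_eq (hdens _) (hdens _) ?_ ?_).le
    · rw [hmass, hmass]
    · rw [hmass]; exact ENNReal.one_ne_top

theorem lintegral_pathNorm_conv_ne_top {μ γ : Measure (PathSpace d T)} [IsProbabilityMeasure μ]
    [IsProbabilityMeasure γ]
    (hμ : ∫⁻ x, ENNReal.ofReal (pathNorm x) ∂μ ≠ ∞)
    (hγ : ∫⁻ x, ENNReal.ofReal (pathNorm x) ∂γ ≠ ∞) :
    ∫⁻ x, ENNReal.ofReal (pathNorm x) ∂μ.conv γ ≠ ∞ := by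
  have hm := (measurable_pathNorm (d := d) (T := T)).ennreal_ofReal
  rw [Measure.lintegral_conv hm]
  refine ne_top_of_le_ne_top (ENNReal.add_ne_top.2 ⟨hμ, hγ⟩) ?_
  calc _ ≤ ∫⁻ x, ∫⁻ y, (ENNReal.ofReal (pathNorm x) + ENNReal.ofReal (pathNorm y)) ∂γ ∂μ := by
        refine lintegral_mono fun x => lintegral_mono fun y => ?_
        rw [← ENNReal.ofReal_add (pathNorm_nonneg _) (pathNorm_nonneg _)]
        exact ENNReal.ofReal_le_ofReal (pathNorm_add_le _ _)
    _ = _ := by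
        simp_rw [lintegral_add_right _ hm]
        rw [lintegral_add_right _ measurable_const]
        simp

/-- Almost surely, the smoothed empirical measures converge to the smoothed law when integrated
against a nonnegative function. -/
theorem ae_tendsto_lintegral_conv_empiricalMeasure {μ : Measure (PathSpace d T)} {Ω : Type*}
    [MeasurableSpace Ω] {P : Measure Ω} {X : ℕ → Ω → PathSpace d T}
    (hX : ∀ n, Measurable (X n))
    (hindep : iIndepFun X P) (hlaw : ∀ n, P.map (X n) = μ) {γ : Measure (PathSpace d T)}
    [IsProbabilityMeasure γ] {f : PathSpace d T → ℝ≥0∞} (hf : Measurable f)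
    (hfi : ∫⁻ x, f x ∂μ.conv γ ≠ ∞) :
    ∀ᵐ ω ∂P, Tendsto (fun N => ∫⁻ x, f x ∂(empiricalMeasure (fun n => X n ω) N).conv γ) atTop
      (𝓝 (∫⁻ x, f x ∂μ.conv γ)) := by
  -- Integrating out the noise first leaves an empirical integral of the fixed function `x ↦ ∫⁻ y, f
  -- (x + y) ∂γ`.
  simp_rw [Measure.lintegral_conv hf] at hfi ⊢
  exact ae_tendsto_lintegral_empiricalMeasure hX hindep hlaw
    (Measurable.lintegral_prod_right' (f := fun p : PathSpace d T × PathSpace d T => f (p.1 + p.2))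
      (by fun_prop)) hfi

end Convergence

/-! ### Conclusion: truncation level first, sample size second. -/

theorem theorem4p7 {d T : ℕ} (hd : 1 ≤ d) (hT : 1 ≤ T)
    (μ : Measure (PathSpace d T)) [IsProbabilityMeasure μ]
    (hμ : Integrable (fun x : PathSpace d T => pathNorm x) μ)
    {Ω : Type*} [MeasurableSpace Ω] (P : Measure Ω) [IsProbabilityMeasure P]
    (X : ℕ → Ω → PathSpace d T) (hX : ∀ n, Measurable (X n))
    (hindep : iIndepFun X P) (hlaw : ∀ n, P.map (X n) = μ)
    (σ : ℝ) (hσ : 0 < σ) (hσ1 : σ ≤ 1) :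
    ∀ᵐ ω ∂P, Tendsto
      (fun N : ℕ => smoothAdaptedWasserstein σ μ (empiricalMeasure (fun n => X n ω) N))
      atTop (𝓝 0) := by
  have hμ' : ∫⁻ x, ENNReal.ofReal (pathNorm x) ∂μ ≠ ∞ := by
    have := hμ.2
    simp_rw [HasFiniteIntegral, ← ofReal_norm, Real.norm_of_nonneg (pathNorm_nonneg _)] at this
    exact this.ne
  have hconv := lintegral_pathNorm_conv_ne_top hμ'
    (lintegral_pathNorm_gaussianNoise_lt_top d T σ).ne
  -- Levels are restricted to `ℕ` so that one almost sure event serves all of them.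
  have htail : ∀ᵐ ω ∂P, ∀ R : ℕ, Tendsto (fun N => ∫⁻ x, pathNormTail R x
      ∂(empiricalMeasure (fun n => X n ω) N).conv (gaussianNoise d T σ)) atTop
      (𝓝 (∫⁻ x, pathNormTail R x ∂μ.conv (gaussianNoise d T σ))) :=
    ae_all_iff.2 fun R => ae_tendsto_lintegral_conv_empiricalMeasure hX hindep hlaw
      (measurable_pathNormTail _)
      (ne_top_of_le_ne_top hconv (lintegral_mono fun x => pathNormTail_le _ x))
  filter_upwards [htail, ae_exists_tendsto_smooth_empiricalMeasure hX hindep hlaw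
    (gaussianNoise_absolutelyContinuous d T hσ)] with ω hω hε
  obtain ⟨ε, hε0, hε⟩ := hε
  rw [ENNReal.tendsto_nhds_zero]
  intro δ hδ
  -- The tail is counted twice: once for the smoothed `μ`, once as the limit of the empirical tails.
  have hR := (tendsto_lintegral_pathNormTail hconv).add (tendsto_lintegral_pathNormTail hconv)
  rw [add_zero] at hR
  obtain ⟨R, hR⟩ := (hR.eventually (gt_mem_nhds hδ)).exists
  have hlim : Tendsto (fun N => 2 * ENNReal.ofReal R * (T * (2 * ε N)) +
      ∫⁻ x, pathNormTail R x ∂μ.conv (gaussianNoise d T σ) +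
      ∫⁻ x, pathNormTail R x
        ∂(empiricalMeasure (fun n => X n ω) N).conv (gaussianNoise d T σ)) atTop
      (𝓝 (2 * ENNReal.ofReal R * (T * (2 * 0)) +
        ∫⁻ x, pathNormTail R x ∂μ.conv (gaussianNoise d T σ) +
        ∫⁻ x, pathNormTail R x ∂μ.conv (gaussianNoise d T σ))) := by
    refine Tendsto.add (Tendsto.add ?_ tendsto_const_nhds) (hω R)
    refine ENNReal.Tendsto.const_mul (ENNReal.Tendsto.const_mul
      (ENNReal.Tendsto.const_mul hε0 (Or.inr (by simp))) (Or.inr (by simp))) (Or.inr ?_)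
    exact ENNReal.mul_ne_top (by simp) ENNReal.ofReal_ne_top
  simp only [mul_zero, zero_add] at hlim
  filter_upwards [hlim.eventually (gt_mem_nhds hR), eventually_ne_atTop 0] with N hN hN0
  obtain ⟨ρ, ρ', h₁, h₂, hρ, hρ'⟩ := hε N hN0
  have := isProbabilityMeasure_empiricalMeasure (fun n => X n ω) hN0
  exact (adaptedWasserstein_le_of_le_add h₁ h₂ hρ hρ' R).trans hN.le
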